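/- Let $\mathbb{K}$ be a field, let $n\ge 3$, and let $C_n$ be the cycle graph on the vertices $x_1,\dots,x_n$. Let $R=\mathbb{K}[x_1,\dots,x_n]$ be the polynomial ring with graded maximal ideal $M=(x_1,\dots,x_n)$, let $\Delta_{C_n}$ be the simplicial complex of independent sets of $C_n$, and let $\mathbb{K}[\Delta_{C_n}]=R/I_{\Delta_{C_n}}$ be its Stanley–Reisner ring, where $I_{\Delta_{C_n}}$ is generated by the monomials $\prod_{x_i\in F}x_i$ with $F$ a minimal non-face of $\Delta_{C_n}$. For a finitely generated graded $R$-module $N$, let $\operatorname{depth}N$ be the length of a maximal $N$-regular sequence in $M$, and let $\operatorname{indim}N=\inf\{\dim R/P\mid P\in\operatorname{Ass}_R N\}$. Call $N$ initially Cohen–Macaulay if $N=0$ or $\operatorname{depth}N=\operatorname{indim}N$, and call a graph $G$ on $x_1,\dots,x_n$ initially Cohen–Macaulay over $\mathbb{K}$ if the $R$-module $\mathbb{K}[\Delta_G]$ is. Then $$C_n\text{ is initially Cohen–Macaulay over }\mathbb{K}\iff n\not\equiv 1\pmod 3.$$ -/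

import Mathlib

noncomputable section

namespace InitialCM

/-- The `I`-depth of an `R`-module `N`: the supremum of the lengths of the `N`-regular sequences
`r₁, …, r_d` with all `r_i` in `I`, where `r_i` has to be a nonzerodivisor on
`N ⧸ (r₁, …, r_{i-1}) N`. When `R` is Noetherian and `N` is finitely generated with `I N ≠ N`,
this is the common length of all maximal `N`-regular sequences in `I`, and the condition
`N ≠ (r₁, …, r_d) N` is automatic. -/
def depth {R : Type*} [CommRing R] (I : Ideal R)
    (N : Type*) [AddCommGroup N] [Module R N] : ℕ∞ :=
  ⨆ (rs : List R) (_ : (∀ r ∈ rs, r ∈ I) ∧ RingTheory.Sequence.IsWeaklyRegular N rs),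
    (rs.length : ℕ∞)

/-- The initial dimension of an `R`-module `N`: the infimum of the coheights
`coht P = dim R ⧸ P`, with `P` running over the associated primes of `N`. -/
def indim (R : Type*) [CommRing R] (N : Type*) [AddCommGroup N] [Module R N] : WithBot ℕ∞ :=
  ⨅ P ∈ associatedPrimes R N, ringKrullDim (R ⧸ P)

/-- The `R`-module `N` is initially Cohen–Macaulay with respect to the (graded) maximal ideal `M`:
it is zero, or its `M`-depth is its initial dimension. The ideal `M` is the maximal ideal if `R`
is local, and the irrelevant ideal `(x₁, …, xₙ)` if `R` is a standard graded polynomial ring. -/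
def IsInitiallyCohenMacaulay {R : Type*} [CommRing R] (M : Ideal R)
    (N : Type*) [AddCommGroup N] [Module R N] : Prop :=
  Subsingleton N ∨ (depth M N : WithBot ℕ∞) = indim R N

/-- The graded maximal ideal `(x_v | v ∈ V)` of the polynomial ring `K[x_v | v ∈ V]`. -/
def irrelevantIdeal (K V : Type*) [Field K] : Ideal (MvPolynomial V K) :=
  Ideal.span (Set.range MvPolynomial.X)

/-- The minimal non-faces of a simplicial complex. Mathlib does not list the empty set among the
faces of a complex; it always counts as a face here, hence the condition `F.Nonempty`. -/
def minimalNonfaces {V : Type*} (Δ : PreAbstractSimplicialComplex V) : Set (Finset V) :=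
  {F | Minimal (fun F : Finset V => F.Nonempty ∧ F ∉ Δ) F}

/-- The Stanley–Reisner ideal of a simplicial complex, generated by the squarefree monomials
`∏_{v ∈ F} x_v`, with `F` running over the minimal non-faces. -/
def stanleyReisnerIdeal (K : Type*) [Field K] {V : Type*} (Δ : PreAbstractSimplicialComplex V) :
    Ideal (MvPolynomial V K) :=
  Ideal.span ((fun F : Finset V => ∏ v ∈ F, MvPolynomial.X v) '' minimalNonfaces Δ)

/-- A simplicial complex is initially Cohen–Macaulay over `K` if its Stanley–Reisner ring
`K[Δ] = K[x_v | v ∈ V] ⧸ I_Δ` is so, as a graded module over the polynomial ring. -/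
def IsInitiallyCohenMacaulayComplex (K : Type*) [Field K] {V : Type*}
    (Δ : PreAbstractSimplicialComplex V) : Prop :=
  IsInitiallyCohenMacaulay (irrelevantIdeal K V) (MvPolynomial V K ⧸ stanleyReisnerIdeal K Δ)

/-- The independence complex of a graph: its (nonempty) faces are the nonempty finite sets of
pairwise non-adjacent vertices. -/
def independenceComplex {V : Type*} (G : SimpleGraph V) : PreAbstractSimplicialComplex V where
  faces := {F | F.Nonempty ∧ G.IsIndepSet (F : Set V)}
  isRelLowerSet_faces := fun _ hF =>
    ⟨hF.1, fun _ hle hne => ⟨hne, Set.Pairwise.mono (Finset.coe_subset.mpr hle) hF.2⟩⟩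

/-- A graph is initially Cohen–Macaulay over `K` if its independence complex is. -/
def IsInitiallyCohenMacaulayGraph (K : Type*) [Field K] {V : Type*} (G : SimpleGraph V) : Prop :=
  IsInitiallyCohenMacaulayComplex K (independenceComplex G)

end InitialCM

end

/-!
Write `R = K[x_1, …, x_n]`, let `J` be the edge ideal of `C_n`, which is the Stanley–Reisner ideal
of the independence complex, and put `k = ⌊n / 3⌋`. The theorem compares the initial dimension
`⌈n / 3⌉` of `R ⧸ J` with its depth `⌈(n - 1) / 3⌉`; they differ exactly if `n ≡ 1 (mod 3)`.

*Initial dimension.* Every associated prime of `R ⧸ J` lies in the prime `(x_v | v ∉ F)` of a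
maximal independent set `F` (`le_indim_of_forall_maximal`), and these primes are associated
(`indim_le_of_maximal`). A maximal independent set of `C_n` is dominating, hence has at least
`n / 3` elements; if `n ≢ 1 (mod 3)`, every third vertex gives one with `⌈n / 3⌉` elements. If
`n ≡ 1 (mod 3)`, the lower bound `⌈n / 3⌉` is all that is needed.

*Regular sequences.* For a vertex `x` of an induced subgraph with edge ideal `J`, the sequence
`0 → R ⧸ (J : x) → R ⧸ J → R ⧸ (J, x) → 0` is exact, and its outer terms belong to smaller induced
subgraphs (`exists_shortExact_edgeIdeal`). By induction, the sums of the variables over pairwise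
disjoint closed neighbourhoods form a regular sequence (`isWeaklyRegular_map_nbhdForm`). The blocks
of three consecutive vertices give such a sequence of length `k` on the cycle.

*Maximality.* Over a Noetherian ring, a regular sequence in `I` has the largest possible length if
`I` kills a nonzero element of the quotient by it (`not_hasRegularSeq_of_socle`); this rests on an
exchange property of regular elements (`HasRegularSeq.quotSMulTop`). For `n = 3k` and `n = 3k + 1`
the product of the variables at the centres of the blocks is such an element
(`depth_cycleGraph_of_mod_ne_two`), so that the depth is `k`. For `n = 3k + 2` the exact sequence of
the last vertex and the depth lemmas `HasRegularSeq.middle` and `HasRegularSeq.left` reduce the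
claim to two induced subgraphs, where neighbourhood forms and the same product settle it
(`depth_cycleGraph_of_mod_eq_two`): the depth is `k + 1`.
-/

noncomputable section

namespace InitialCM

open Function RingTheory.Sequence MvPolynomial

/-! ### Regular sequences of prescribed length -/

section RegularSequences

variable {R : Type*} [CommRing R] {I : Ideal R}

/-- There is a weakly `N`-regular sequence of length `d` in `I`. -/
def HasRegularSeq (I : Ideal R) (N : Type*) [AddCommGroup N] [Module R N] (d : ℕ) : Prop :=
  ∃ rs : List R, rs.length = d ∧ (∀ r ∈ rs, r ∈ I) ∧ IsWeaklyRegular N rs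

variable {N : Type*} [AddCommGroup N] [Module R N]

lemma hasRegularSeq_zero : HasRegularSeq I N 0 :=
  ⟨[], rfl, by simp, .nil R N⟩

lemma hasRegularSeq_succ_iff {d : ℕ} :
    HasRegularSeq I N (d + 1) ↔
      ∃ r ∈ I, IsSMulRegular N r ∧ HasRegularSeq I (QuotSMulTop r N) d := by
  constructor
  · rintro ⟨_ | ⟨r, rs⟩, hl, hI, hreg⟩
    · simp at hl
    · rw [isWeaklyRegular_cons_iff] at hreg
      exact ⟨r, hI r (by simp), hreg.1, rs, by simpa using hl,
        fun s hs => hI s (by simp [hs]), hreg.2⟩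
  · rintro ⟨r, hr, hrN, rs, hl, hI, hreg⟩
    exact ⟨r :: rs, by simp [hl], by simpa [hr] using hI, .cons hrN hreg⟩

lemma HasRegularSeq.of_subsingleton [Subsingleton N] (d : ℕ) : HasRegularSeq I N d := by
  induction d generalizing N with
  | zero => exact hasRegularSeq_zero
  | succ d ih =>
    exact hasRegularSeq_succ_iff.mpr ⟨0, zero_mem I, fun _ _ _ => Subsingleton.elim _ _, ih⟩

lemma hasRegularSeq_one_iff : HasRegularSeq I N 1 ↔ ∃ r ∈ I, IsSMulRegular N r := by
  simp [hasRegularSeq_succ_iff, hasRegularSeq_zero]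

lemma HasRegularSeq.mono {d e : ℕ} (h : HasRegularSeq I N d) (hed : e ≤ d) :
    HasRegularSeq I N e := by
  obtain ⟨rs, hl, hI, hreg⟩ := h
  refine ⟨rs.take e, by simp [hl, hed], fun r hr => hI r (List.mem_of_mem_take hr), ?_⟩
  rw [← List.take_append_drop e rs, isWeaklyRegular_append_iff] at hreg
  exact hreg.1

lemma HasRegularSeq.congr {N' : Type*} [AddCommGroup N'] [Module R N'] (e : N ≃ₗ[R] N') {d : ℕ}
    (h : HasRegularSeq I N d) : HasRegularSeq I N' d := by
  obtain ⟨rs, hl, hI, hreg⟩ := h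
  exact ⟨rs, hl, hI, (e.isWeaklyRegular_congr rs).mp hreg⟩

/-- If the longest weakly regular sequences in `I` have length `d`, then `d` is the depth. -/
lemma depth_eq_of_hasRegularSeq {d : ℕ} (h : HasRegularSeq I N d)
    (h' : ¬ HasRegularSeq I N (d + 1)) : depth I N = d := by
  refine le_antisymm (iSup₂_le fun rs hrs => ?_) ?_
  · by_contra hlt
    rw [not_le, Nat.cast_lt] at hlt
    exact h' (HasRegularSeq.mono ⟨rs, rfl, hrs⟩ hlt)
  · obtain ⟨rs, rfl, hrs⟩ := h
    exact le_iSup₂_of_le rs hrs le_rfl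

open scoped Pointwise in
/-- `N ⧸ (a, b) N` does not depend on the order in which `a` and `b` are divided out. -/
def quotSMulTopComm (a b : R) (N : Type*) [AddCommGroup N] [Module R N] :
    QuotSMulTop a (QuotSMulTop b N) ≃ₗ[R] QuotSMulTop b (QuotSMulTop a N) :=
  have h (c d : R) : (d • (⊤ : Submodule R N)).map (c • (⊤ : Submodule R N)).mkQ =
      d • (⊤ : Submodule R (QuotSMulTop c N)) := by
    rw [Submodule.map_pointwise_smul, Submodule.map_top, Submodule.range_mkQ]
  Submodule.quotEquivOfEq _ _ (h b a).symm ≪≫ₗ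
    Submodule.quotientQuotientEquivQuotientSup (b • ⊤) (a • ⊤) ≪≫ₗ
    Submodule.quotEquivOfEq _ _ (sup_comm _ _) ≪≫ₗ
    (Submodule.quotientQuotientEquivQuotientSup (a • ⊤) (b • ⊤)).symm ≪≫ₗ
    Submodule.quotEquivOfEq _ _ (h a b)

lemma isSMulRegular_quotSMulTop_iff {a b : R} :
    IsSMulRegular (QuotSMulTop a N) b ↔ ∀ u v : N, b • u = a • v → ∃ w, u = a • w := by
  rw [isSMulRegular_quotient_iff_mem_of_smul_mem]
  simp only [Submodule.mem_smul_pointwise_iff_exists, Submodule.mem_top, true_and]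
  exact ⟨fun h u v huv => (h u ⟨v, huv.symm⟩).imp fun _ => Eq.symm,
    fun h u ⟨v, hv⟩ => (h u v hv.symm).imp fun _ => Eq.symm⟩

lemma IsSMulRegular.swap {a c : R} (ha : IsSMulRegular N a)
    (hac : IsSMulRegular (QuotSMulTop a N) c) : IsSMulRegular (QuotSMulTop c N) a := by
  rw [isSMulRegular_quotSMulTop_iff] at hac ⊢
  intro u v huv
  obtain ⟨w, rfl⟩ := hac v u huv.symm
  exact ⟨w, ha (by simpa only [smul_comm c a] using huv)⟩

section ShortExact

variable {N' N'' : Type*} [AddCommGroup N'] [Module R N'] [AddCommGroup N''] [Module R N'']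
  {f : N' →ₗ[R] N} {g : N →ₗ[R] N''}

/-- Dividing out an `N''`-regular element keeps `0 → N' → N → N'' → 0` exact on the left. -/
lemma quotSMulTop_map_injective (hf : Injective f) (hfg : Exact f g) {r : R}
    (hr : IsSMulRegular N'' r) : Injective (QuotSMulTop.map r f) := by
  rw [injective_iff_map_eq_zero]
  intro x hx
  obtain ⟨x, rfl⟩ := Submodule.mkQ_surjective _ x
  rw [Submodule.mkQ_apply] at hx ⊢
  rw [QuotSMulTop.map_apply_mk, Submodule.Quotient.mk_eq_zero,
    Submodule.mem_smul_pointwise_iff_exists] at hx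
  obtain ⟨y, -, hy⟩ := hx
  have hgy : g y = 0 := hr.right_eq_zero_of_smul (by
    rw [← map_smul, hy, hfg.apply_apply_eq_zero])
  obtain ⟨z, rfl⟩ := (hfg y).mp hgy
  rw [Submodule.Quotient.mk_eq_zero, Submodule.mem_smul_pointwise_iff_exists]
  exact ⟨z, trivial, hf (by rw [map_smul, hy])⟩

lemma isSMulRegular_of_shortExact (hf : Injective f) (hfg : Exact f g) {r : R}
    (h' : IsSMulRegular N' r) (h'' : IsSMulRegular N'' r) : IsSMulRegular N r :=
  isSMulRegular_of_range_eq_ker hf hfg.linearMap_ker_eq.symm h' h''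

end ShortExact

/-- A sequence that is weakly regular on both ends of a short exact sequence is so in the middle. -/
lemma isWeaklyRegular_of_shortExact {N' N'' : Type*} [AddCommGroup N'] [Module R N']
    [AddCommGroup N''] [Module R N''] {f : N' →ₗ[R] N} {g : N →ₗ[R] N''} (hf : Injective f)
    (hfg : Exact f g) (hg : Surjective g) {rs : List R} (h' : IsWeaklyRegular N' rs)
    (h'' : IsWeaklyRegular N'' rs) : IsWeaklyRegular N rs := by
  induction rs generalizing N N' N'' with
  | nil => exact .nil R N
  | cons r rs ih =>
    rw [isWeaklyRegular_cons_iff] at h' h'' ⊢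
    exact ⟨isSMulRegular_of_shortExact hf hfg h'.1 h''.1,
      ih (quotSMulTop_map_injective hf hfg h''.1) (QuotSMulTop.map_exact r hfg hg)
        (QuotSMulTop.map_surjective r hg) h'.2 h''.2⟩

end RegularSequences

/-! ### Depth over Noetherian rings -/

section Noetherian

variable {R : Type*} [CommRing R] [IsNoetherianRing R] {I : Ideal R}
  {N : Type*} [AddCommGroup N] [Module R N] [Module.Finite R N]

/-- Prime avoidance: an ideal contains a nonzerodivisor on `N` unless it kills a nonzero element. -/
lemma exists_isSMulRegular_iff :
    (∃ r ∈ I, IsSMulRegular N r) ↔ ∀ u : N, (∀ r ∈ I, r • u = 0) → u = 0 := by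
  constructor
  · rintro ⟨r, hr, hreg⟩ u hu
    exact hreg.right_eq_zero_of_smul (hu r hr)
  · intro h
    by_contra! hI
    have hsub : (I : Set R) ⊆ ⋃ p ∈ associatedPrimes R N, p := by
      rw [biUnion_associatedPrimes_eq_compl_regular R N]
      exact fun r hr => hI r hr
    obtain ⟨p, hp, hIp⟩ := (Ideal.subset_union_prime_finite (associatedPrimes.finite R N) ⊥ ⊥
      fun p hp _ _ => IsAssociatedPrime.isPrime hp).mp hsub
    obtain ⟨hprime, u, rfl⟩ := isAssociatedPrime_iff.mp hp
    have hu : u = 0 := h u fun r hr => by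
      simpa [Submodule.mem_colon_singleton] using hIp hr
    exact hprime.ne_top (by simp [hu])

lemma exists_isSMulRegular_pair {N' : Type*} [AddCommGroup N'] [Module R N'] [Module.Finite R N']
    (h : ∃ r ∈ I, IsSMulRegular N r) (h' : ∃ r ∈ I, IsSMulRegular N' r) :
    ∃ r ∈ I, IsSMulRegular N r ∧ IsSMulRegular N' r := by
  have hprod : ∃ r ∈ I, IsSMulRegular (N × N') r := by
    rw [exists_isSMulRegular_iff] at h h' ⊢
    rintro ⟨u, u'⟩ hu
    simp only [Prod.smul_mk, Prod.mk_eq_zero] at hu ⊢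
    exact ⟨h u fun r hr => (hu r hr).1, h' u' fun r hr => (hu r hr).2⟩
  obtain ⟨r, hr, hreg⟩ := hprod
  exact ⟨r, hr, hreg.of_injective (LinearMap.inl R N N') LinearMap.inl_injective,
    hreg.of_injective (LinearMap.inr R N N') LinearMap.inr_injective⟩

/-- Whether `I` kills a nonzero element of `N ⧸ a N` does not depend on the `N`-regular element
`a ∈ I`: multiplication by `b / a` identifies these elements with those for `b`. -/
lemma exists_isSMulRegular_quotSMulTop {a b : R} (ha : a ∈ I) (haN : IsSMulRegular N a)
    (hbN : IsSMulRegular N b) (h : ∃ r ∈ I, IsSMulRegular (QuotSMulTop a N) r) :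
    ∃ r ∈ I, IsSMulRegular (QuotSMulTop b N) r := by
  obtain ⟨c, hc, hcreg⟩ := h
  rw [isSMulRegular_quotSMulTop_iff] at hcreg
  rw [exists_isSMulRegular_iff]
  intro u hu
  obtain ⟨u, rfl⟩ := Submodule.mkQ_surjective _ u
  simp only [← map_smul] at hu
  simp only [Submodule.mkQ_apply, Submodule.Quotient.mk_eq_zero,
    Submodule.mem_smul_pointwise_iff_exists, Submodule.mem_top, true_and] at hu ⊢
  obtain ⟨v, hv⟩ := hu a ha
  obtain ⟨w, hw⟩ := hu c hc
  have hcv : c • v = a • w := hbN (by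
    change b • c • v = b • a • w
    rw [smul_comm b c, hv, smul_comm b a, hw, smul_comm c a])
  obtain ⟨z, rfl⟩ := hcreg v w hcv
  exact ⟨z, haN (by simpa only [smul_comm b a] using hv)⟩

/-- Any regular element can serve as the first member of a regular sequence of maximal length. -/
theorem HasRegularSeq.quotSMulTop {d : ℕ} (h : HasRegularSeq I N (d + 1)) {b : R} (hb : b ∈ I)
    (hbN : IsSMulRegular N b) : HasRegularSeq I (QuotSMulTop b N) d := by
  induction d generalizing N b with
  | zero => exact hasRegularSeq_zero
  | succ d ih =>
    obtain ⟨a, ha, haN, hseq⟩ := hasRegularSeq_succ_iff.mp h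
    have hqa : ∃ r ∈ I, IsSMulRegular (QuotSMulTop a N) r :=
      hasRegularSeq_one_iff.mp (hseq.mono (by omega))
    have hqb := exists_isSMulRegular_quotSMulTop ha haN hbN hqa
    -- An element regular on all of `N`, `N ⧸ a N` and `N ⧸ b N` links `a` to `b`.
    obtain ⟨c, hc, hcN, hcab⟩ : ∃ c ∈ I, IsSMulRegular N c ∧
        IsSMulRegular (QuotSMulTop a N × QuotSMulTop b N) c := by
      refine exists_isSMulRegular_pair ⟨b, hb, hbN⟩ ?_
      obtain ⟨c, hc, hca, hcb⟩ := exists_isSMulRegular_pair hqa hqb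
      exact ⟨c, hc, hca.prodMap hcb⟩
    have hca := hcab.of_injective (LinearMap.inl R _ _) LinearMap.inl_injective
    have hcb := hcab.of_injective (LinearMap.inr R _ _) LinearMap.inr_injective
    have h₁ : HasRegularSeq I (QuotSMulTop c N) (d + 1) :=
      hasRegularSeq_succ_iff.mpr ⟨a, ha, IsSMulRegular.swap haN hca,
        (ih hseq hc hca).congr (quotSMulTopComm c a N)⟩
    exact hasRegularSeq_succ_iff.mpr ⟨c, hc, hcb,
      (ih h₁ hb (IsSMulRegular.swap hbN hcb)).congr (quotSMulTopComm b c N)⟩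

lemma HasRegularSeq.quotient_ofList {d : ℕ} {rs : List R} (hI : ∀ r ∈ rs, r ∈ I)
    (hrs : IsWeaklyRegular N rs) (h : HasRegularSeq I N (rs.length + d)) :
    HasRegularSeq I (N ⧸ (Ideal.ofList rs • ⊤ : Submodule R N)) d := by
  induction rs generalizing N with
  | nil =>
    rw [List.length_nil, zero_add] at h
    exact h.congr (Submodule.quotEquivOfEqBot _ (by simp)).symm
  | cons r rs ih =>
    rw [isWeaklyRegular_cons_iff] at hrs
    rw [List.length_cons, add_right_comm] at h
    exact (ih (fun s hs => hI s (by simp [hs])) hrs.2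
      (h.quotSMulTop (hI r (by simp)) hrs.1)).congr
        (Submodule.quotOfListConsSMulTopEquivQuotSMulTopInner N r rs).symm

/-- A regular sequence is of maximal length as soon as `I` kills a nonzero element of the
quotient by it. -/
theorem not_hasRegularSeq_of_socle {rs : List R} (hI : ∀ r ∈ rs, r ∈ I)
    (hrs : IsWeaklyRegular N rs) {u : N} (hu : u ∉ (Ideal.ofList rs • ⊤ : Submodule R N))
    (hIu : ∀ r ∈ I, r • u ∈ (Ideal.ofList rs • ⊤ : Submodule R N)) :
    ¬ HasRegularSeq I N (rs.length + 1) := by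
  intro h
  have h₁ := hasRegularSeq_one_iff.mp (h.quotient_ofList hI hrs)
  rw [exists_isSMulRegular_iff] at h₁
  refine hu ((Submodule.Quotient.mk_eq_zero _).mp (h₁ (Submodule.Quotient.mk u) fun r hr => ?_))
  rw [← Submodule.Quotient.mk_smul, Submodule.Quotient.mk_eq_zero]
  exact hIu r hr

section ShortExact

variable {N' N'' : Type*} [AddCommGroup N'] [Module R N'] [AddCommGroup N''] [Module R N'']
  [Module.Finite R N'] [Module.Finite R N''] {f : N' →ₗ[R] N} {g : N →ₗ[R] N''}

/-- Depth lemma: `depth N ≥ min (depth N') (depth N'')`. -/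
lemma HasRegularSeq.middle (hf : Injective f) (hfg : Exact f g) (hg : Surjective g) {d : ℕ}
    (h' : HasRegularSeq I N' d) (h'' : HasRegularSeq I N'' d) : HasRegularSeq I N d := by
  induction d generalizing N N' N'' with
  | zero => exact hasRegularSeq_zero
  | succ d ih =>
    obtain ⟨r, hr, hr', hr''⟩ := exists_isSMulRegular_pair
      (hasRegularSeq_one_iff.mp (h'.mono (by omega)))
      (hasRegularSeq_one_iff.mp (h''.mono (by omega)))
    exact hasRegularSeq_succ_iff.mpr ⟨r, hr, isSMulRegular_of_shortExact hf hfg hr' hr'',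
      ih (quotSMulTop_map_injective hf hfg hr'') (QuotSMulTop.map_exact r hfg hg)
        (QuotSMulTop.map_surjective r hg) (h'.quotSMulTop hr hr') (h''.quotSMulTop hr hr'')⟩

/-- Depth lemma: `depth N' ≥ min (depth N) (depth N'' + 1)`. -/
lemma HasRegularSeq.left (hf : Injective f) (hfg : Exact f g) (hg : Surjective g) {d : ℕ}
    (h : HasRegularSeq I N (d + 1)) (h'' : HasRegularSeq I N'' d) :
    HasRegularSeq I N' (d + 1) := by
  induction d generalizing N N' N'' with
  | zero =>
    obtain ⟨r, hr, hrN⟩ := hasRegularSeq_one_iff.mp h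
    exact hasRegularSeq_one_iff.mpr ⟨r, hr, hrN.of_injective f hf⟩
  | succ d ih =>
    obtain ⟨r, hr, hrN, hr''⟩ := exists_isSMulRegular_pair
      (hasRegularSeq_one_iff.mp (h.mono (by omega)))
      (hasRegularSeq_one_iff.mp (h''.mono (by omega)))
    exact hasRegularSeq_succ_iff.mpr ⟨r, hr, hrN.of_injective f hf,
      ih (quotSMulTop_map_injective hf hfg hr'') (QuotSMulTop.map_exact r hfg hg)
        (QuotSMulTop.map_surjective r hg) (h.quotSMulTop hr hrN) (h''.quotSMulTop hr hr'')⟩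

end ShortExact

end Noetherian

/-! ### Variables missing from the generators of an ideal -/

section FreeVariable

variable {K V : Type*} [Field K]

lemma mul_divMonomial_of_mem_supported {x : V} {s : MvPolynomial V K}
    (hs : s ∈ supported K ({x}ᶜ : Set V)) (r : MvPolynomial V K) :
    (r * s).divMonomial (Finsupp.single x 1) = r.divMonomial (Finsupp.single x 1) * s := by
  induction hs using Algebra.adjoin_induction generalizing r with
  | mem s hs =>
    obtain ⟨v, hv, rfl⟩ := hs
    have hvx : x ≠ v := fun h => hv h.symm
    ext m
    classical
    rw [coeff_divMonomial, coeff_mul_X', coeff_mul_X', coeff_divMonomial]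
    simp only [Finsupp.mem_support_iff, Finsupp.add_apply, Finsupp.single_apply, if_neg hvx,
      zero_add]
    split_ifs with hm
    · congr 1
      ext w
      simp only [Finsupp.coe_tsub, Finsupp.coe_add, Pi.sub_apply, Pi.add_apply,
        Finsupp.single_apply]
      by_cases hw : v = w
      · subst hw; simp [hvx]
      · simp [hw]
    · rfl
  | algebraMap c =>
    ext m
    simp only [coeff_divMonomial, algebraMap_eq, mul_comm _ (C c), coeff_C_mul]
  | add s t _ _ hs ht => rw [mul_add, add_divMonomial, hs, ht, mul_add]
  | mul s t _ _ hs ht => rw [← mul_assoc, ht, hs, mul_assoc]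

/-- A variable is a nonzerodivisor modulo an ideal whose generators do not involve it. -/
lemma mem_of_X_mul_mem {x : V} {S : Set (MvPolynomial V K)}
    (hS : S ⊆ supported K ({x}ᶜ : Set V)) {f : MvPolynomial V K}
    (hf : X x * f ∈ Ideal.span S) : f ∈ Ideal.span S := by
  have hdiv : ∀ p ∈ Ideal.span S, ∀ r : MvPolynomial V K,
      (r * p).divMonomial (Finsupp.single x 1) ∈ Ideal.span S := by
    intro p hp
    induction hp using Submodule.span_induction with
    | mem s hs =>
      intro r
      rw [mul_divMonomial_of_mem_supported (hS hs)]
      exact Ideal.mul_mem_left _ _ (Ideal.subset_span hs)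
    | zero => simp
    | add p q _ _ hp hq =>
      intro r
      rw [mul_add, add_divMonomial]
      exact add_mem (hp r) (hq r)
    | smul t p _ hp =>
      intro r
      rw [smul_eq_mul, ← mul_assoc]
      exact hp (r * t)
  simpa [X_mul_divMonomial] using hdiv _ hf 1

/-- The substitution `x ↦ x + g`, which fixes all other variables. -/
def shift (x : V) (g : MvPolynomial V K) : MvPolynomial V K →ₐ[K] MvPolynomial V K :=
  open Classical in aeval (Function.update X x (X x + g))

lemma shift_X_self (x : V) (g : MvPolynomial V K) : shift x g (X x) = X x + g := by
  simp [shift]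

lemma shift_of_mem_supported {x : V} {g s : MvPolynomial V K}
    (hs : s ∈ supported K ({x}ᶜ : Set V)) : shift x g s = s := by
  have : Set.EqOn (shift x g) (AlgHom.id K (MvPolynomial V K))
      (supported K ({x}ᶜ : Set V) : Set (MvPolynomial V K)) := by
    rw [supported, AlgHom.eqOn_adjoin_iff]
    rintro _ ⟨v, hv, rfl⟩
    have hvx : v ≠ x := hv
    simp [shift, hvx]
  exact this hs

lemma shift_mem_span {x : V} {g : MvPolynomial V K} {S : Set (MvPolynomial V K)}
    (hS : S ⊆ supported K ({x}ᶜ : Set V)) {f : MvPolynomial V K} (hf : f ∈ Ideal.span S) :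
    shift x g f ∈ Ideal.span S := by
  have : Ideal.span S ≤ (Ideal.span S).comap (shift x g) := Ideal.span_le.mpr fun s hs => by
    rw [SetLike.mem_coe, Ideal.mem_comap, shift_of_mem_supported (hS hs)]
    exact Ideal.subset_span hs
  exact this hf

lemma shift_neg_shift {x : V} {g : MvPolynomial V K} (hg : g ∈ supported K ({x}ᶜ : Set V))
    (f : MvPolynomial V K) : shift x g (shift x (-g) f) = f := by
  suffices (shift x g).comp (shift x (-g)) = AlgHom.id K _ from DFunLike.congr_fun this f
  ext1 v
  rw [AlgHom.comp_apply]
  by_cases hv : v = x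
  · subst hv
    rw [shift_X_self, map_add, shift_X_self, map_neg, shift_of_mem_supported hg]
    simp
  · have : (X v : MvPolynomial V K) ∈ supported K ({x}ᶜ : Set V) :=
      Algebra.subset_adjoin ⟨v, hv, rfl⟩
    rw [shift_of_mem_supported this, shift_of_mem_supported this]
    rfl

/-- If `x` occurs neither in `g` nor in the generators of an ideal, a linear change of coordinates
turns `x + g` into the nonzerodivisor `x` of `mem_of_X_mul_mem`. -/
lemma mem_of_X_add_mul_mem {x : V} {S : Set (MvPolynomial V K)}
    (hS : S ⊆ supported K ({x}ᶜ : Set V)) {f g : MvPolynomial V K}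
    (hg : g ∈ supported K ({x}ᶜ : Set V)) (hf : (X x + g) * f ∈ Ideal.span S) :
    f ∈ Ideal.span S := by
  have h := shift_mem_span (g := -g) hS hf
  rw [map_mul, map_add, shift_X_self, shift_of_mem_supported hg, neg_add_cancel_right] at h
  simpa [shift_neg_shift hg] using shift_mem_span (g := g) hS (mem_of_X_mul_mem hS h)

end FreeVariable

/-! ### Edge ideals of induced subgraphs -/

section EdgeIdeal

variable (K : Type*) [Field K] {V : Type*} (G : SimpleGraph V)

/-- The edge ideal of the subgraph of `G` induced on `W`. It lives in the polynomial ring on all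
vertices of `G`, the variables outside `W` being among the generators. -/
def edgeIdeal (W : Set V) : Ideal (MvPolynomial V K) :=
  Ideal.span ({p | ∃ v ∉ W, p = X v} ∪ {p | ∃ u ∈ W, ∃ v ∈ W, G.Adj u v ∧ p = X u * X v})

/-- The closed neighbourhood of a vertex: the vertex and its neighbours. -/
def closedNbhd (b : V) : Set V := {v | v = b ∨ G.Adj b v}

open Classical in
/-- The sum of the variables in the closed neighbourhood of `b`. -/
def nbhdForm [Fintype V] (b : V) : MvPolynomial V K :=
  ∑ v with v ∈ closedNbhd G b, X v

variable {K G} {W : Set V}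

lemma X_mem_edgeIdeal {v : V} (hv : v ∉ W) : X v ∈ edgeIdeal K G W :=
  Ideal.subset_span (Or.inl ⟨v, hv, rfl⟩)

lemma X_mul_X_mem_edgeIdeal {u v : V} (h : G.Adj u v) : X u * X v ∈ edgeIdeal K G W := by
  by_cases hu : u ∈ W
  · by_cases hv : v ∈ W
    · exact Ideal.subset_span (Or.inr ⟨u, hu, v, hv, h, rfl⟩)
    · exact Ideal.mul_mem_left _ _ (X_mem_edgeIdeal hv)
  · exact Ideal.mul_mem_right _ _ (X_mem_edgeIdeal hu)

lemma edgeIdeal_le {J : Ideal (MvPolynomial V K)} (h : ∀ v ∉ W, X v ∈ J)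
    (h' : ∀ u ∈ W, ∀ v ∈ W, G.Adj u v → X u * X v ∈ J) : edgeIdeal K G W ≤ J := by
  refine Ideal.span_le.mpr ?_
  rintro _ (⟨v, hv, rfl⟩ | ⟨u, hu, v, hv, huv, rfl⟩)
  · exact h v hv
  · exact h' u hu v hv huv

lemma edgeIdeal_anti {W' : Set V} (h : W' ⊆ W) : edgeIdeal K G W ≤ edgeIdeal K G W' :=
  edgeIdeal_le (fun _ hv => X_mem_edgeIdeal fun hv' => hv (h hv'))
    fun _ _ _ _ huv => X_mul_X_mem_edgeIdeal huv

lemma X_mem_supported {x v : V} (h : v ≠ x) :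
    (X v : MvPolynomial V K) ∈ supported K ({x}ᶜ : Set V) :=
  Algebra.subset_adjoin ⟨v, h, rfl⟩

/-- The generators of the edge ideal do not involve an isolated vertex. -/
lemma generators_subset_supported {x : V} (hx : x ∈ W) (hiso : ∀ v ∈ W, ¬ G.Adj x v) :
    ({p | ∃ v ∉ W, p = X v} ∪ {p | ∃ u ∈ W, ∃ v ∈ W, G.Adj u v ∧ p = X u * X v} :
      Set (MvPolynomial V K)) ⊆ supported K ({x}ᶜ : Set V) := by
  rintro _ (⟨v, hv, rfl⟩ | ⟨u, hu, v, hv, huv, rfl⟩)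
  · exact X_mem_supported fun h => hv (h ▸ hx)
  · refine mul_mem (X_mem_supported fun h => ?_) (X_mem_supported fun h => ?_)
    · exact hiso v hv (h ▸ huv)
    · exact hiso u hu (h ▸ huv.symm)

/-- The short exact sequence `0 → R ⧸ (J : x) → R ⧸ J → R ⧸ (J, x) → 0` of the edge ideal `J` of
`W`: the colon ideal `(J : x)` is the edge ideal of `W` without the neighbours of `x`, and `(J, x)`
is the edge ideal of `W` without `x`. -/
theorem exists_shortExact_edgeIdeal {x : V} (hx : x ∈ W) :
    ∃ (f : (MvPolynomial V K ⧸ edgeIdeal K G (W \ G.neighborSet x)) →ₗ[MvPolynomial V K]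
        MvPolynomial V K ⧸ edgeIdeal K G W)
      (g : (MvPolynomial V K ⧸ edgeIdeal K G W) →ₗ[MvPolynomial V K]
        MvPolynomial V K ⧸ edgeIdeal K G (W \ {x})),
      Injective f ∧ Exact f g ∧ Surjective g := by
  have hmul : edgeIdeal K G (W \ G.neighborSet x) ≤
      Submodule.comap (LinearMap.lsmul (MvPolynomial V K) (MvPolynomial V K) (X x))
        (edgeIdeal K G W) := by
    refine edgeIdeal_le (fun v hv => ?_) (fun u _ v _ huv => ?_)
    · change X x * X v ∈ edgeIdeal K G W
      by_cases hvx : G.Adj x v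
      · exact X_mul_X_mem_edgeIdeal hvx
      · exact Ideal.mul_mem_left _ _ (X_mem_edgeIdeal fun hvW => hv ⟨hvW, hvx⟩)
    · change X x * (X u * X v) ∈ edgeIdeal K G W
      exact Ideal.mul_mem_left _ _ (X_mul_X_mem_edgeIdeal huv)
  refine ⟨Submodule.mapQ _ _ _ hmul,
    Submodule.factor (edgeIdeal_anti Set.sdiff_subset), ?_, ?_, Submodule.factor_surjective _⟩
  · rw [injective_iff_map_eq_zero]
    intro p hp
    obtain ⟨p, rfl⟩ := Submodule.mkQ_surjective _ p
    rw [Submodule.mkQ_apply] at hp ⊢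
    rw [Submodule.mapQ_apply, Submodule.Quotient.mk_eq_zero] at hp
    rw [Submodule.Quotient.mk_eq_zero]
    exact mem_of_X_mul_mem
      (generators_subset_supported (W := W \ G.neighborSet x) ⟨hx, G.irrefl⟩ fun v hv => hv.2)
      (edgeIdeal_anti Set.sdiff_subset hp)
  · intro p
    obtain ⟨p, rfl⟩ := Submodule.mkQ_surjective _ p
    constructor
    · intro hp
      replace hp : p ∈ edgeIdeal K G (W \ {x}) := (Submodule.Quotient.mk_eq_zero _).mp hp
      have hle : edgeIdeal K G (W \ {x}) ≤ Ideal.span {X x} ⊔ edgeIdeal K G W := by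
        refine edgeIdeal_le (fun v hv => ?_)
          (fun u _ v _ huv => Ideal.mem_sup_right (X_mul_X_mem_edgeIdeal huv))
        by_cases hvx : v = x
        · exact Ideal.mem_sup_left (hvx ▸ Ideal.mem_span_singleton_self _)
        · exact Ideal.mem_sup_right (X_mem_edgeIdeal fun hvW => hv ⟨hvW, hvx⟩)
      obtain ⟨a, j, hj, rfl⟩ := Ideal.mem_span_singleton_sup.mp (hle hp)
      refine ⟨Submodule.Quotient.mk a, ?_⟩
      rw [Submodule.mapQ_apply, Submodule.mkQ_apply, Submodule.Quotient.eq]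
      change X x * a - (a * X x + j) ∈ _
      rw [show X x * a - (a * X x + j) = -j by ring]
      exact neg_mem hj
    · rintro ⟨a, ha⟩
      obtain ⟨a, rfl⟩ := Submodule.mkQ_surjective _ a
      rw [← ha]
      refine (Submodule.Quotient.mk_eq_zero (edgeIdeal K G (W \ {x}))).mpr ?_
      exact Ideal.mul_mem_right _ _ (X_mem_edgeIdeal fun h => h.2 rfl)

lemma mk_mem_ideal_smul_top_iff {R : Type*} [CommRing R] {J A : Ideal R} {p : R} :
    (Submodule.Quotient.mk p : R ⧸ J) ∈ (A • ⊤ : Submodule R (R ⧸ J)) ↔ p ∈ A ⊔ J := by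
  rw [Ideal.smul_top_eq_map, Submodule.restrictScalars_mem, Ideal.Quotient.algebraMap_eq]
  exact Ideal.mem_quotient_iff_mem_sup

/-! ### Closed neighbourhoods and regular sequences -/

variable [Fintype V]

lemma nbhdForm_mem_irrelevantIdeal (b : V) : nbhdForm K G b ∈ irrelevantIdeal K V :=
  sum_mem fun v _ => Ideal.subset_span ⟨v, rfl⟩

lemma nbhdForm_mem_supported {x b : V} (h : x ∉ closedNbhd G b) :
    nbhdForm K G b ∈ supported K ({x}ᶜ : Set V) := by
  classical
  refine sum_mem fun v hv => X_mem_supported ?_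
  rintro rfl
  exact h (by simpa using hv)

lemma exists_nbhdForm_eq {x b : V} (h : x ∈ closedNbhd G b) :
    ∃ g ∈ supported K ({x}ᶜ : Set V), nbhdForm K G b = X x + g := by
  classical
  refine ⟨_, sum_mem fun v hv => ?_,
    (Finset.add_sum_erase _ X (Finset.mem_filter.mpr ⟨Finset.mem_univ x, h⟩)).symm⟩
  exact X_mem_supported (Finset.ne_of_mem_erase hv)

/-- A form that involves an isolated vertex extends a regular sequence of forms that do not. -/
lemma isWeaklyRegular_append_of_isolated {x b : V} {L : List V} (hx : x ∈ W)
    (hiso : ∀ v ∈ W, ¬ G.Adj x v) (hb : x ∈ closedNbhd G b) (hL : ∀ c ∈ L, x ∉ closedNbhd G c)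
    (hreg : IsWeaklyRegular (MvPolynomial V K ⧸ edgeIdeal K G W) (L.map (nbhdForm K G))) :
    IsWeaklyRegular (MvPolynomial V K ⧸ edgeIdeal K G W) ((L ++ [b]).map (nbhdForm K G)) := by
  rw [List.map_append, isWeaklyRegular_append_iff]
  refine ⟨hreg, ?_⟩
  rw [List.map_singleton, isWeaklyRegular_singleton_iff, isSMulRegular_quotient_iff_mem_of_smul_mem]
  intro p hp
  obtain ⟨p, rfl⟩ := Submodule.mkQ_surjective _ p
  rw [← map_smul, Submodule.mkQ_apply, mk_mem_ideal_smul_top_iff] at hp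
  rw [Submodule.mkQ_apply, mk_mem_ideal_smul_top_iff]
  obtain ⟨g, hg, hbg⟩ := exists_nbhdForm_eq (K := K) hb
  rw [hbg, edgeIdeal, ← Ideal.span_union, smul_eq_mul] at hp
  rw [edgeIdeal, ← Ideal.span_union]
  refine mem_of_X_add_mul_mem (Set.union_subset ?_ (generators_subset_supported hx hiso)) hg hp
  intro s hs
  obtain ⟨c, hc, rfl⟩ := List.mem_map.mp hs
  exact nbhdForm_mem_supported (hL c hc)

/-- Pairwise disjoint closed neighbourhoods in the induced subgraph on `W` give a regular sequence.
Splitting off a neighbour `x` of the last centre `b` leaves two smaller induced subgraphs: one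
without `x`, and one in which `x` has become isolated. -/
theorem isWeaklyRegular_map_nbhdForm (W : Set V) (L : List V) (hL : ∀ b ∈ L, b ∈ W)
    (hd : L.Pairwise fun b c => ∀ v ∈ W, v ∈ closedNbhd G b → v ∉ closedNbhd G c) :
    IsWeaklyRegular (MvPolynomial V K ⧸ edgeIdeal K G W) (L.map (nbhdForm K G)) := by
  induction W using WellFoundedLT.induction generalizing L with
  | ind W ihW =>
    induction L using List.reverseRecOn with
    | nil => exact .nil _ _
    | append_singleton L b ihL =>
      have hb : b ∈ W := hL b (by simp)
      have hLW : ∀ c ∈ L, c ∈ W := fun c hc => hL c (by simp [hc])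
      have hd' := List.pairwise_append.mp hd
      have hdis : ∀ v ∈ W, v ∈ closedNbhd G b → ∀ c ∈ L, v ∉ closedNbhd G c :=
        fun v hv hvb c hc hvc => hd'.2.2 c hc b (by simp) v hv hvc hvb
      by_cases h : ∃ x ∈ W, G.Adj b x
      · obtain ⟨x, hx, hbx⟩ := h
        have hxb : x ∈ closedNbhd G b := Or.inr hbx
        have hLx : ∀ c ∈ L, x ∉ closedNbhd G c := hdis x hx hxb
        obtain ⟨f, g, hf, hfg, hg⟩ := exists_shortExact_edgeIdeal (K := K) (G := G) hx
        refine isWeaklyRegular_of_shortExact hf hfg hg ?_ ?_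
        · refine isWeaklyRegular_append_of_isolated ⟨hx, G.irrefl⟩ (fun v hv => hv.2) hxb hLx ?_
          refine ihW _ ⟨Set.sdiff_subset, fun hsub => (hsub hb).2 hbx.symm⟩ L (fun c hc => ?_)
            (hd'.1.imp fun h v hv => h v hv.1)
          exact ⟨hLW c hc, fun hxc => hLx c hc (Or.inr (G.adj_symm hxc))⟩
        · refine ihW (W \ {x}) ⟨Set.sdiff_subset, fun hsub => (hsub hx).2 rfl⟩ _ (fun c hc => ?_)
            (hd.imp fun h v hv => h v hv.1)
          refine ⟨hL c hc, ?_⟩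
          rintro rfl
          rcases List.mem_append.mp hc with hc | hc
          · exact hLx c hc (Or.inl rfl)
          · exact hbx.ne (List.mem_singleton.mp hc).symm
      · push Not at h
        exact isWeaklyRegular_append_of_isolated hb h (Or.inl rfl) (hdis b hb (Or.inl rfl))
          (ihL hLW hd'.1)

end EdgeIdeal

/-! ### The Stanley–Reisner ideal of an independence complex -/

theorem stanleyReisnerIdeal_independenceComplex (K : Type*) [Field K] {V : Type*}
    (G : SimpleGraph V) :
    stanleyReisnerIdeal K (independenceComplex G) = edgeIdeal K G Set.univ := by
  classical
  have hface (F : Finset V) : F ∈ independenceComplex G ↔ F.Nonempty ∧ G.IsIndepSet (F : Set V) :=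
    Iff.rfl
  apply le_antisymm
  · refine Ideal.span_le.mpr ?_
    rintro _ ⟨F, hF, rfl⟩
    replace hF : Minimal (fun F : Finset V => F.Nonempty ∧ F ∉ independenceComplex G) F := hF
    have hF' : ¬ G.IsIndepSet (F : Set V) := fun h => hF.prop.2 ((hface F).mpr ⟨hF.prop.1, h⟩)
    rw [SimpleGraph.isIndepSet_iff, Set.Pairwise] at hF'
    push Not at hF'
    obtain ⟨u, hu, v, hv, huv, hadj⟩ := hF'
    change ∏ w ∈ F, (X w : MvPolynomial V K) ∈ _
    rw [← Finset.mul_prod_erase F _ hu,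
      ← Finset.mul_prod_erase (F.erase u) _ (Finset.mem_erase.mpr ⟨huv.symm, hv⟩), ← mul_assoc]
    exact Ideal.mul_mem_right _ _ (X_mul_X_mem_edgeIdeal hadj)
  · refine edgeIdeal_le (fun v hv => absurd (Set.mem_univ v) hv) fun u _ v _ huv => ?_
    refine Ideal.subset_span ⟨{u, v}, ⟨⟨by simp, fun h => ?_⟩, fun F hF hle => ?_⟩,
      Finset.prod_pair huv.ne⟩
    · exact h.2 (by simp) (by simp) huv.ne huv
    · by_contra hnot
      refine hF.2 ((hface F).mpr ⟨hF.1, fun a ha b hb hab hadj => hnot ?_⟩)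
      have ha' := hle ha
      have hb' := hle hb
      simp only [Finset.mem_insert, Finset.mem_singleton] at ha' hb'
      intro w hw
      simp only [Finset.mem_insert, Finset.mem_singleton] at hw
      rcases hw with rfl | rfl <;> rcases ha' with rfl | rfl <;> rcases hb' with rfl | rfl <;>
        first | exact absurd rfl hab | assumption

/-! ### Associated primes and initial dimension -/

section Indim

variable {K : Type*} [Field K] {V : Type*} {G : SimpleGraph V} {F : Set V}

open Classical in
/-- The substitution setting all variables outside `F` to zero. -/
def restrictVars (K : Type*) [Field K] (F : Set V) : MvPolynomial V K →ₐ[K] MvPolynomial F K :=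
  aeval fun v => if h : v ∈ F then X ⟨v, h⟩ else 0

lemma restrictVars_X_of_mem {v : V} (h : v ∈ F) : restrictVars K F (X v) = X ⟨v, h⟩ := by
  simp [restrictVars, h]

lemma restrictVars_X_of_notMem {v : V} (h : v ∉ F) : restrictVars K F (X v) = 0 := by
  simp [restrictVars, h]

lemma restrictVars_surjective : Surjective (restrictVars K F) := by
  have h : (restrictVars K F).comp (rename Subtype.val) = AlgHom.id K _ := by
    ext1 v
    simp [restrictVars_X_of_mem v.2]
  exact fun p => ⟨rename Subtype.val p, DFunLike.congr_fun h p⟩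

lemma mem_span_of_restrictVars_eq_zero {p : MvPolynomial V K} (hp : restrictVars K F p = 0) :
    p ∈ Ideal.span (X '' Fᶜ : Set (MvPolynomial V K)) := by
  have h : ((Ideal.Quotient.mkₐ K (Ideal.span (X '' Fᶜ : Set (MvPolynomial V K)))).comp
      (rename Subtype.val)).comp (restrictVars K F) = Ideal.Quotient.mkₐ K _ := by
    ext1 v
    by_cases hv : v ∈ F
    · simp [restrictVars_X_of_mem hv]
    · have : Ideal.Quotient.mk (Ideal.span (X '' Fᶜ : Set (MvPolynomial V K))) (X v) = 0 :=
        Ideal.Quotient.eq_zero_iff_mem.mpr (Ideal.subset_span ⟨v, hv, rfl⟩)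
      simp [restrictVars_X_of_notMem hv, this]
  have hp' := DFunLike.congr_fun h p
  rw [AlgHom.comp_apply, hp, map_zero] at hp'
  exact Ideal.Quotient.eq_zero_iff_mem.mp hp'.symm

lemma edgeIdeal_le_ker_restrictVars (hF : G.IsIndepSet F) :
    edgeIdeal K G Set.univ ≤ RingHom.ker (restrictVars K F) := by
  refine edgeIdeal_le (fun v hv => absurd (Set.mem_univ v) hv) fun u _ v _ huv => ?_
  rw [RingHom.mem_ker, map_mul]
  by_cases hu : u ∈ F
  · by_cases hv : v ∈ F
    · exact absurd huv (hF hu hv huv.ne)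
    · rw [restrictVars_X_of_notMem hv, mul_zero]
  · rw [restrictVars_X_of_notMem hu, zero_mul]

/-- A polynomial outside the edge ideal has a monomial supported on an independent set. -/
lemma exists_isIndepSet_support {p : MvPolynomial V K} (hp : p ∉ edgeIdeal K G Set.univ) :
    ∃ m ∈ p.support, G.IsIndepSet (m.support : Set V) := by
  by_contra! h
  refine hp ?_
  rw [← p.support_sum_monomial_coeff]
  refine sum_mem fun m hm => ?_
  have hm' := h m hm
  rw [SimpleGraph.isIndepSet_iff, Set.Pairwise] at hm'
  push Not at hm'
  obtain ⟨u, hu, v, hv, huv, hadj⟩ := hm'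
  have hdvd : X u * X v ∣ monomial m (p.coeff m) := by
    rw [X, X, monomial_mul, monomial_dvd_monomial]
    refine ⟨Or.inr fun w => ?_, by simp⟩
    have hu' : m u ≠ 0 := by simpa using hu
    have hv' : m v ≠ 0 := by simpa using hv
    classical
    simp only [Finsupp.add_apply, Finsupp.single_apply]
    split_ifs with h₁ h₂ h₂
    · exact absurd (h₁.trans h₂.symm) huv
    · subst h₁; omega
    · subst h₂; omega
    · omega
  exact Ideal.mem_of_dvd _ hdvd (X_mul_X_mem_edgeIdeal hadj)

variable [Finite V]

lemma ringKrullDim_mvPolynomial_subtype :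
    ringKrullDim (MvPolynomial F K) = (Nat.card F : WithBot ℕ∞) := by
  rw [ringKrullDim_of_isNoetherianRing, ringKrullDim_eq_zero_of_field, zero_add]

/-- Every associated prime of `K[Δ_G]` lies in the prime `(x_v | v ∉ F)` of some maximal independent
set `F`, and so has coheight at least `|F|`. -/
theorem le_indim_of_forall_maximal {d : ℕ}
    (h : ∀ F : Set V, Maximal G.IsIndepSet F → d ≤ Nat.card F) :
    (d : WithBot ℕ∞) ≤ indim (MvPolynomial V K) (MvPolynomial V K ⧸ edgeIdeal K G Set.univ) := by
  refine le_iInf₂ fun P hP => ?_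
  obtain ⟨-, u, rfl⟩ := isAssociatedPrime_iff.mp hP
  have hP' := IsAssociatedPrime.isPrime hP
  obtain ⟨p, rfl⟩ := Ideal.Quotient.mk_surjective u
  have hp : p ∉ edgeIdeal K G Set.univ := fun hp =>
    hP'.ne_top (by simp [Ideal.Quotient.eq_zero_iff_mem.mpr hp])
  obtain ⟨m, hm, hind⟩ := exists_isIndepSet_support hp
  obtain ⟨F, hmF, hF⟩ := Finite.exists_le_maximal (p := G.IsIndepSet) hind
  have hpF : restrictVars K F p ≠ 0 := fun h0 => by
    obtain ⟨v, hv, hmv⟩ := mem_ideal_span_X_image.mp (mem_span_of_restrictVars_eq_zero h0) m hm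
    exact hv (hmF (by simpa using hmv))
  have hle : ∀ r ∈ (⊥ : Submodule (MvPolynomial V K)
      (MvPolynomial V K ⧸ edgeIdeal K G Set.univ)).colon {Ideal.Quotient.mk _ p},
      restrictVars K F r = 0 := by
    intro r hr
    rw [Submodule.mem_colon_singleton, Submodule.mem_bot] at hr
    have hrp : r * p ∈ edgeIdeal K G Set.univ := Ideal.Quotient.eq_zero_iff_mem.mp hr
    have := edgeIdeal_le_ker_restrictVars hF.prop hrp
    rw [RingHom.mem_ker, map_mul] at this
    exact (mul_eq_zero.mp this).resolve_right hpF
  calc (d : WithBot ℕ∞) ≤ (Nat.card F : WithBot ℕ∞) := by exact_mod_cast h F hF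
    _ = ringKrullDim (MvPolynomial F K) := ringKrullDim_mvPolynomial_subtype.symm
    _ ≤ _ := ringKrullDim_le_of_surjective
        (Ideal.Quotient.lift _ (restrictVars K F : MvPolynomial V K →+* MvPolynomial F K) hle)
        (Ideal.Quotient.lift_surjective_of_surjective _ _ restrictVars_surjective)

/-- For a maximal independent set `F`, the prime `(x_v | v ∉ F)` is the annihilator of
`∏_{v ∈ F} x_v` in `K[Δ_G]`. -/
theorem indim_le_of_maximal (hF : Maximal G.IsIndepSet F) :
    indim (MvPolynomial V K) (MvPolynomial V K ⧸ edgeIdeal K G Set.univ) ≤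
      (Nat.card F : WithBot ℕ∞) := by
  classical
  have := Fintype.ofFinite V
  set q : MvPolynomial V K := ∏ v with v ∈ F, X v with hq
  have hassoc : RingHom.ker (restrictVars K F) ∈
      associatedPrimes (MvPolynomial V K) (MvPolynomial V K ⧸ edgeIdeal K G Set.univ) := by
    refine isAssociatedPrime_iff.mpr ⟨RingHom.ker_isPrime _, Ideal.Quotient.mk _ q, ?_⟩
    ext r
    rw [Submodule.mem_colon_singleton, Submodule.mem_bot]
    change _ ↔ Ideal.Quotient.mk (edgeIdeal K G Set.univ) (r * q) = 0
    rw [Ideal.Quotient.eq_zero_iff_mem, RingHom.mem_ker]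
    constructor
    · intro hr
      have hle : Ideal.span (X '' Fᶜ) ≤ Submodule.comap
          (LinearMap.lsmul (MvPolynomial V K) (MvPolynomial V K) q)
          (edgeIdeal K G Set.univ) := by
        refine Ideal.span_le.mpr ?_
        rintro _ ⟨v, hv, rfl⟩
        obtain ⟨w, hw, hvw⟩ : ∃ w ∈ F, G.Adj w v := by
          by_contra! hno
          have hind : G.IsIndepSet (insert v F) := Set.pairwise_insert.mpr
            ⟨hF.prop, fun w hw _ => ⟨fun h => hno w hw h.symm, hno w hw⟩⟩
          exact hv (hF.le_of_ge hind (Set.subset_insert v F) (Set.mem_insert v F))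
        change q * X v ∈ edgeIdeal K G Set.univ
        rw [hq, ← Finset.prod_erase_mul _ _ (Finset.mem_filter.mpr ⟨Finset.mem_univ w, hw⟩),
          mul_assoc]
        exact Ideal.mul_mem_left _ _ (X_mul_X_mem_edgeIdeal hvw)
      rw [mul_comm]
      exact hle (mem_span_of_restrictVars_eq_zero hr)
    · intro hr
      have h := edgeIdeal_le_ker_restrictVars hF.prop hr
      rw [RingHom.mem_ker, map_mul] at h
      refine (mul_eq_zero.mp h).resolve_right ?_
      rw [hq, map_prod]
      refine Finset.prod_ne_zero_iff.mpr ?_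
      intro v hv
      rw [restrictVars_X_of_mem (Finset.mem_filter.mp hv).2]
      exact X_ne_zero _
  refine (iInf₂_le _ hassoc).trans (le_of_eq ?_)
  rw [← ringKrullDim_mvPolynomial_subtype (K := K)]
  exact ringKrullDim_eq_of_ringEquiv
    (RingHom.quotientKerEquivOfSurjective
      (f := (restrictVars K F : MvPolynomial V K →+* MvPolynomial F K)) restrictVars_surjective)

end Indim

/-! ### Adjacency and independent sets in cycles -/

section Cycle

lemma cycleGraph_adj_iff_val {n : ℕ} (hn : 3 ≤ n) {u v : Fin n} :
    (SimpleGraph.cycleGraph n).Adj u v ↔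
      u.val + 1 = v.val ∨ v.val + 1 = u.val ∨ (u.val = 0 ∧ v.val + 1 = n) ∨
        (v.val = 0 ∧ u.val + 1 = n) := by
  have hsub (a b : Fin n) : (a - b).val = if b.val ≤ a.val then a.val - b.val
      else n + a.val - b.val := by
    split_ifs with h
    · exact Fin.sub_val_of_le h
    · exact Fin.coe_sub_iff_lt.mpr (not_le.mp h)
  rw [SimpleGraph.cycleGraph_adj', hsub, hsub]
  split_ifs <;> omega

lemma mem_closedNbhd_cycleGraph {n : ℕ} (hn : 3 ≤ n) {b v : Fin n} :
    v ∈ closedNbhd (SimpleGraph.cycleGraph n) b ↔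
      v.val = b.val ∨ b.val + 1 = v.val ∨ v.val + 1 = b.val ∨ (b.val = 0 ∧ v.val + 1 = n) ∨
        (v.val = 0 ∧ b.val + 1 = n) := by
  rw [closedNbhd, Set.mem_ofPred_eq, cycleGraph_adj_iff_val hn, Fin.ext_iff]

/-- A maximal independent set dominates the cycle, and every vertex dominates three vertices. -/
lemma le_three_mul_card_of_maximal {n : ℕ} (hn : 3 ≤ n) {F : Set (Fin n)}
    (hF : Maximal (SimpleGraph.cycleGraph n).IsIndepSet F) : n ≤ 3 * Nat.card F := by
  classical
  obtain ⟨m, rfl⟩ : ∃ m, n = m + 2 := ⟨n - 2, by omega⟩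
  have hcover : (Finset.univ : Finset (Fin (m + 2))) ⊆
      F.toFinset ∪ (F.toFinset.image (· + 1) ∪ F.toFinset.image (· - 1)) := by
    intro v _
    by_contra hv
    simp only [Finset.mem_union, Set.mem_toFinset, Finset.mem_image, not_or, not_exists,
      not_and] at hv
    obtain ⟨hv, hv₁, hv₂⟩ := hv
    have hno : ∀ w ∈ F, ¬ (SimpleGraph.cycleGraph (m + 2)).Adj w v := by
      intro w hw h
      rcases SimpleGraph.cycleGraph_adj.mp h with h | h
      · exact hv₂ w hw (by rw [← h]; abel)
      · exact hv₁ w hw (by rw [← h]; abel)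
    have hind : (SimpleGraph.cycleGraph (m + 2)).IsIndepSet (insert v F) :=
      Set.pairwise_insert.mpr
        ⟨hF.prop, fun w hw _ => ⟨fun h => hno w hw h.symm, hno w hw⟩⟩
    exact hv (hF.le_of_ge hind (Set.subset_insert v F) (Set.mem_insert v F))
  have hcard := Finset.card_le_card hcover
  have h₁ := Finset.card_union_le F.toFinset
    (F.toFinset.image (· + 1) ∪ F.toFinset.image (· - 1))
  have h₂ := Finset.card_union_le (F.toFinset.image (· + 1)) (F.toFinset.image (· - 1))
  have h₃ := Finset.card_image_le (s := F.toFinset) (f := (· + 1))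
  have h₄ := Finset.card_image_le (s := F.toFinset) (f := (· - 1))
  rw [Nat.card_eq_card_toFinset]
  rw [Finset.card_univ, Fintype.card_fin] at hcard
  omega

/-- Every third vertex of a cycle whose length is not `1` modulo `3`. -/
lemma maximal_isIndepSet_mod_three {n : ℕ} (hn : 3 ≤ n) (h : n % 3 ≠ 1) :
    Maximal (SimpleGraph.cycleGraph n).IsIndepSet {v | v.val % 3 = 0} := by
  refine ⟨fun u hu v hv huv hadj => ?_, fun F hF hle v hv => ?_⟩
  · rw [cycleGraph_adj_iff_val hn] at hadj
    rw [Set.mem_ofPred_eq] at hu hv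
    omega
  · by_contra hv3
    rw [Set.mem_ofPred_eq] at hv3
    have key (w : ℕ) (hw : w < n) (hw3 : w % 3 = 0) (h : v.val + 1 = w ∨ w + 1 = v.val ∨
        (v.val = 0 ∧ w + 1 = n) ∨ (w = 0 ∧ v.val + 1 = n)) : False :=
      have hadj : (SimpleGraph.cycleGraph n).Adj v ⟨w, hw⟩ := (cycleGraph_adj_iff_val hn).mpr h
      hF hv (hle hw3) hadj.ne hadj
    rcases (show v.val % 3 = 1 ∨ v.val % 3 = 2 by omega) with h3 | h3
    · exact key (v.val - 1) (by omega) (by omega) (by omega)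
    · by_cases hlast : v.val + 1 = n
      · exact key 0 (by omega) (by omega) (by omega)
      · exact key (v.val + 1) (by omega) (by omega) (by omega)

lemma card_mod_three_le {n : ℕ} : Nat.card {v : Fin n | v.val % 3 = 0} ≤ (n + 2) / 3 := by
  have hinj : Injective fun v : {v : Fin n | v.val % 3 = 0} =>
      (⟨v.1.val / 3, by have := v.1.isLt; omega⟩ : Fin ((n + 2) / 3)) := by
    intro u v huv
    have hu : u.1.val % 3 = 0 := u.2
    have hv : v.1.val % 3 = 0 := v.2
    rw [Fin.mk.injEq] at huv
    exact Subtype.ext (Fin.ext (by omega))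
  simpa using Nat.card_le_card_of_injective _ hinj

/-! ### Regular sequences and socle elements for cycles -/

variable {K : Type*} [Field K] {n k : ℕ}

lemma nbhdForm_cycleGraph (hn : 3 ≤ n) {b c d : Fin n} (h : c.val + 1 = b.val ∨
      (b.val = 0 ∧ c.val + 1 = n)) (h' : b.val + 1 = d.val ∨ (d.val = 0 ∧ b.val + 1 = n)) :
    nbhdForm K (SimpleGraph.cycleGraph n) b = X c + X b + X d := by
  classical
  have : Finset.univ.filter (· ∈ closedNbhd (SimpleGraph.cycleGraph n) b) = {c, b, d} := by
    ext v
    simp only [Finset.mem_filter, Finset.mem_univ, true_and, mem_closedNbhd_cycleGraph hn,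
      Finset.mem_insert, Finset.mem_singleton, Fin.ext_iff]
    omega
  rw [nbhdForm, this, Finset.sum_insert, Finset.sum_pair, add_assoc]
  · rw [ne_eq, Fin.ext_iff]; omega
  · rw [Finset.mem_insert, Finset.mem_singleton, Fin.ext_iff, Fin.ext_iff]; omega

/-- The ideal generated by an induced subgraph of the cycle and the forms of a list of centres. -/
def cycleQuotIdeal (K : Type*) [Field K] {n : ℕ} (W : Set (Fin n)) (L : List (Fin n)) :
    Ideal (MvPolynomial (Fin n) K) :=
  Ideal.ofList (L.map (nbhdForm K (SimpleGraph.cycleGraph n))) ⊔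
    edgeIdeal K (SimpleGraph.cycleGraph n) W

variable {W : Set (Fin n)} {L : List (Fin n)}

lemma nbhdForm_mem_cycleQuotIdeal {b : Fin n} (hb : b ∈ L) :
    nbhdForm K (SimpleGraph.cycleGraph n) b ∈ cycleQuotIdeal K W L :=
  Ideal.mem_sup_left (Ideal.subset_span (List.mem_map.mpr ⟨b, hb, rfl⟩))

lemma edgeIdeal_le_cycleQuotIdeal :
    edgeIdeal K (SimpleGraph.cycleGraph n) W ≤ cycleQuotIdeal K W L :=
  le_sup_right

lemma X_mul_X_mem_cycleQuotIdeal {b v : Fin n} (hb : b ∈ L)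
    (hv : v ∈ closedNbhd (SimpleGraph.cycleGraph n) b) :
    X v * X b ∈ cycleQuotIdeal K W L := by
  classical
  have hadj : ∀ w, (SimpleGraph.cycleGraph n).Adj b w → X w * X b ∈ cycleQuotIdeal K W L :=
    fun w hw => edgeIdeal_le_cycleQuotIdeal (X_mul_X_mem_edgeIdeal hw.symm)
  rcases hv with rfl | hv
  · have h := Ideal.mul_mem_right (X v) _ (nbhdForm_mem_cycleQuotIdeal (K := K) (W := W) hb)
    rw [nbhdForm,
      ← Finset.add_sum_erase _ _ (Finset.mem_filter.mpr ⟨Finset.mem_univ v, Or.inl rfl⟩), add_mul,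
      Finset.sum_mul] at h
    refine (add_mem_cancel_right (sum_mem fun w hw => ?_)).mp h
    rw [Finset.mem_erase, Finset.mem_filter] at hw
    exact hadj w (hw.2.2.resolve_left hw.1)
  · exact hadj v hv

lemma irrelevantIdeal_smul_mem {R : Type*} [Field R] {V : Type*} {A : Ideal (MvPolynomial V R)}
    {p : MvPolynomial V R} (h : ∀ v, X v * p ∈ A) : ∀ r ∈ irrelevantIdeal R V, r * p ∈ A := by
  intro r hr
  induction hr using Submodule.span_induction with
  | mem _ hx => obtain ⟨v, rfl⟩ := hx; exact h v
  | zero => simp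
  | add a b _ _ ha hb => rw [add_mul]; exact add_mem ha hb
  | smul c a _ ha => rw [smul_eq_mul, mul_assoc]; exact Ideal.mul_mem_left _ _ ha

lemma hasRegularSeq_of_pairwise (hL : ∀ b ∈ L, b ∈ W)
    (hd : L.Pairwise fun b c => ∀ v ∈ W, v ∈ closedNbhd (SimpleGraph.cycleGraph n) b →
      v ∉ closedNbhd (SimpleGraph.cycleGraph n) c) :
    HasRegularSeq (irrelevantIdeal K (Fin n))
      (MvPolynomial (Fin n) K ⧸ edgeIdeal K (SimpleGraph.cycleGraph n) W) L.length := by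
  refine ⟨_, List.length_map _, fun r hr => ?_, isWeaklyRegular_map_nbhdForm W L hL hd⟩
  obtain ⟨b, -, rfl⟩ := List.mem_map.mp hr
  exact nbhdForm_mem_irrelevantIdeal b

lemma not_hasRegularSeq_of_pairwise (hL : ∀ b ∈ L, b ∈ W)
    (hd : L.Pairwise fun b c => ∀ v ∈ W, v ∈ closedNbhd (SimpleGraph.cycleGraph n) b →
      v ∉ closedNbhd (SimpleGraph.cycleGraph n) c) {p : MvPolynomial (Fin n) K}
    (hp : p ∉ cycleQuotIdeal K W L) (hXp : ∀ v, X v * p ∈ cycleQuotIdeal K W L) :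
    ¬ HasRegularSeq (irrelevantIdeal K (Fin n))
      (MvPolynomial (Fin n) K ⧸ edgeIdeal K (SimpleGraph.cycleGraph n) W) (L.length + 1) := by
  have hreg := isWeaklyRegular_map_nbhdForm (K := K) W L hL hd
  rw [← List.length_map (as := L) (nbhdForm K (SimpleGraph.cycleGraph n))]
  refine not_hasRegularSeq_of_socle (fun r hr => ?_) hreg (u := Submodule.Quotient.mk p)
    (fun h => hp (mk_mem_ideal_smul_top_iff.mp h)) fun r hr => ?_
  · obtain ⟨b, -, rfl⟩ := List.mem_map.mp hr
    exact nbhdForm_mem_irrelevantIdeal b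
  · rw [← Submodule.Quotient.mk_smul, mk_mem_ideal_smul_top_iff]
    exact irrelevantIdeal_smul_mem hXp r hr

variable [NeZero n]

lemma val_ofNat_of_lt {m : ℕ} (h : m < n) : (Fin.ofNat n m).val = m := by
  rw [Fin.val_ofNat, Nat.mod_eq_of_lt h]

/-- The centres `1, 4, …, 3k - 2` of `k` disjoint blocks of three consecutive vertices. -/
def blockCenters (n k : ℕ) [NeZero n] : List (Fin n) :=
  (List.range k).map fun i => Fin.ofNat n (3 * i + 1)

lemma exists_of_mem_blockCenters {b : Fin n} (hk : 3 * k ≤ n) (hb : b ∈ blockCenters n k) :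
    ∃ i < k, b.val = 3 * i + 1 := by
  obtain ⟨i, hi, rfl⟩ := List.mem_map.mp hb
  rw [List.mem_range] at hi
  exact ⟨i, hi, val_ofNat_of_lt (by omega)⟩

lemma mem_blockCenters {i : ℕ} (hi : i < k) : Fin.ofNat n (3 * i + 1) ∈ blockCenters n k :=
  List.mem_map.mpr ⟨i, List.mem_range.mpr hi, rfl⟩

lemma nbhdForm_blockCenter (hn : 3 ≤ n) {i : ℕ} (hi : 3 * i + 3 ≤ n) :
    nbhdForm K (SimpleGraph.cycleGraph n) (Fin.ofNat n (3 * i + 1)) =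
      X (Fin.ofNat n (3 * i)) + X (Fin.ofNat n (3 * i + 1)) + X (Fin.ofNat n (3 * i + 2)) := by
  have h₀ := val_ofNat_of_lt (show 3 * i < n by omega)
  have h₁ := val_ofNat_of_lt (show 3 * i + 1 < n by omega)
  have h₂ := val_ofNat_of_lt (show 3 * i + 2 < n by omega)
  exact nbhdForm_cycleGraph hn (by omega) (by omega)

/-- The product of the variables at the block centres. -/
def blockProd (K : Type*) [Field K] (n k : ℕ) [NeZero n] : MvPolynomial (Fin n) K :=
  ∏ i ∈ Finset.range k, X (Fin.ofNat n (3 * i + 1))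

/-- Substitution detecting the product of the block centres: in each block it sends the variables
to `0`, `y` and `-y`, where `y` is the variable at the centre; variables outside the blocks go to
`0`. -/
def blockSubst (K : Type*) [Field K] (n k : ℕ) [NeZero n] :
    MvPolynomial (Fin n) K →ₐ[K] MvPolynomial (Fin n) K :=
  aeval fun v => if 3 * k ≤ v.val ∨ v.val % 3 = 0 then 0 else
    if v.val % 3 = 1 then X v else - X (Fin.ofNat n (v.val - 1))

lemma blockSubst_X_zero {v : Fin n} (h : 3 * k ≤ v.val ∨ v.val % 3 = 0) :
    blockSubst K n k (X v) = 0 := by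
  rw [blockSubst, aeval_X, if_pos h]

lemma blockSubst_X_center {i : ℕ} (hi : i < k) (hk : 3 * k ≤ n) :
    blockSubst K n k (X (Fin.ofNat n (3 * i + 1))) = X (Fin.ofNat n (3 * i + 1)) := by
  have h := val_ofNat_of_lt (show 3 * i + 1 < n by omega)
  rw [blockSubst, aeval_X, if_neg (by rw [h]; omega), if_pos (by rw [h]; omega)]

lemma blockSubst_X_succ {i : ℕ} (hi : i < k) (hk : 3 * k ≤ n) :
    blockSubst K n k (X (Fin.ofNat n (3 * i + 2))) = - X (Fin.ofNat n (3 * i + 1)) := by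
  have h := val_ofNat_of_lt (show 3 * i + 2 < n by omega)
  rw [blockSubst, aeval_X, if_neg (by rw [h]; omega), if_neg (by rw [h]; omega), h]
  rfl

lemma blockSubst_cases (v : Fin n) (hk : 3 * k ≤ n) :
    (3 * k ≤ v.val ∨ v.val % 3 = 0) ∨
      ∃ i < k, v = Fin.ofNat n (3 * i + 1) ∨ v = Fin.ofNat n (3 * i + 2) := by
  by_cases h : 3 * k ≤ v.val ∨ v.val % 3 = 0
  · exact Or.inl h
  · refine Or.inr ⟨v.val / 3, by omega, ?_⟩
    rw [Fin.ext_iff, Fin.ext_iff, val_ofNat_of_lt (by omega), val_ofNat_of_lt (by omega)]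
    omega

/-- The product of the block centres is nonzero in the quotient by the forms of the centres. -/
lemma blockProd_notMem (hn : 3 ≤ n) (hk : 3 * k ≤ n) (hW : ∀ v ∉ W, 3 * k ≤ v.val ∨ v.val % 3 = 0)
    (hL : ∀ b ∈ L, b ∈ blockCenters n k ∨ (n = 3 * k + 2 ∧ b.val + 1 = n)) :
    blockProd K n k ∉ cycleQuotIdeal K W L := by
  -- The substitution sends the ideal into the one generated by the squares of the variables.
  have hle : cycleQuotIdeal K W L ≤ (Ideal.span ((fun s => monomial s (1 : K)) ''
      Set.range fun v : Fin n => Finsupp.single v 2)).comap (blockSubst K n k) := by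
    refine sup_le (Ideal.span_le.mpr ?_) (edgeIdeal_le (fun v hv => ?_) fun u _ v _ huv => ?_)
    · intro s hs
      obtain ⟨b, hb, rfl⟩ := List.mem_map.mp hs
      rw [SetLike.mem_coe, Ideal.mem_comap]
      suffices blockSubst K n k (nbhdForm K (SimpleGraph.cycleGraph n) b) = 0 by
        rw [this]; exact zero_mem _
      rcases hL b hb with hb | ⟨hnk, hbn⟩
      · obtain ⟨i, hi, rfl⟩ := List.mem_map.mp hb
        rw [List.mem_range] at hi
        rw [nbhdForm_blockCenter hn (by omega), map_add, map_add, blockSubst_X_center hi hk,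
          blockSubst_X_succ hi hk, blockSubst_X_zero
            (Or.inr (by rw [val_ofNat_of_lt (by omega)]; omega))]
        ring
      · rw [nbhdForm_cycleGraph hn (c := Fin.ofNat n (3 * k)) (d := Fin.ofNat n 0)
          (by rw [val_ofNat_of_lt (by omega)]; omega)
          (by rw [val_ofNat_of_lt (by omega)]; omega), map_add, map_add,
          blockSubst_X_zero (Or.inl (by rw [val_ofNat_of_lt (by omega)])),
          blockSubst_X_zero (Or.inl (by omega)),
          blockSubst_X_zero (Or.inr (by rw [val_ofNat_of_lt (by omega)]))]
        ring
    · rw [Ideal.mem_comap, blockSubst_X_zero (hW v hv)]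
      exact zero_mem _
    · rw [Ideal.mem_comap, map_mul]
      have hsq (w : Fin n) : (X w * X w : MvPolynomial (Fin n) K) ∈
          Ideal.span ((fun s => monomial s (1 : K)) ''
            Set.range fun v : Fin n => Finsupp.single v 2) := by
        refine Ideal.subset_span ⟨_, ⟨w, rfl⟩, ?_⟩
        simp only [X, monomial_mul, ← Finsupp.single_add, one_mul]
      rw [cycleGraph_adj_iff_val hn] at huv
      rcases blockSubst_cases (k := k) u hk with hu | ⟨i, hi, hu⟩
      · rw [blockSubst_X_zero hu, zero_mul]; exact zero_mem _
      rcases blockSubst_cases (k := k) v hk with hv | ⟨j, hj, hv⟩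
      · rw [blockSubst_X_zero hv, mul_zero]; exact zero_mem _
      have h₁ := val_ofNat_of_lt (show 3 * i + 1 < n by omega)
      have h₂ := val_ofNat_of_lt (show 3 * i + 2 < n by omega)
      have h₃ := val_ofNat_of_lt (show 3 * j + 1 < n by omega)
      have h₄ := val_ofNat_of_lt (show 3 * j + 2 < n by omega)
      obtain rfl : i = j := by
        rcases hu with rfl | rfl <;> rcases hv with rfl | rfl <;> omega
      rcases hu with rfl | rfl <;> rcases hv with rfl | rfl <;>
        simp only [blockSubst_X_center hi hk, blockSubst_X_succ hi hk, mul_neg, neg_mul, neg_neg,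
          neg_mem_iff, hsq]
  intro hmem
  have h := hle hmem
  have hprod : blockProd K n k =
      monomial (∑ i ∈ Finset.range k, Finsupp.single (Fin.ofNat n (3 * i + 1)) 1) (1 : K) := by
    rw [blockProd, monomial_sum_one]
    rfl
  rw [Ideal.mem_comap, blockProd, map_prod, Finset.prod_congr rfl fun i hi =>
    blockSubst_X_center (K := K) (Finset.mem_range.mp hi) hk] at h
  change blockProd K n k ∈ _ at h
  rw [hprod, mem_ideal_span_monomial_image] at h
  obtain ⟨_, ⟨v, rfl⟩, hv⟩ := h _ (by
    rw [mem_support_iff, coeff_monomial, if_pos rfl]; exact one_ne_zero)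
  have hv2 := hv v
  rw [Finsupp.single_eq_same, Finsupp.finsetSum_apply] at hv2
  simp only [Finsupp.single_apply, ← Finset.card_filter] at hv2
  have hcard : ((Finset.range k).filter fun i => Fin.ofNat n (3 * i + 1) = v).card ≤ 1 := by
    refine Finset.card_le_one.mpr fun i hi j hj => ?_
    rw [Finset.mem_filter, Finset.mem_range, Fin.ext_iff] at hi hj
    rw [val_ofNat_of_lt (by omega)] at hi hj
    omega
  omega

lemma X_mul_blockProd_mem_of_lt (hn : 3 ≤ n) (hk : 3 * k ≤ n) (hL : blockCenters n k ⊆ L)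
    {v : Fin n} (hv : v.val < 3 * k) : X v * blockProd K n k ∈ cycleQuotIdeal K W L := by
  have hi : v.val / 3 < k := by omega
  rw [blockProd, ← Finset.mul_prod_erase _ _ (Finset.mem_range.mpr hi), ← mul_assoc]
  refine Ideal.mul_mem_right _ _ (X_mul_X_mem_cycleQuotIdeal (hL (mem_blockCenters hi)) ?_)
  rw [mem_closedNbhd_cycleGraph hn, val_ofNat_of_lt (by omega)]
  omega

/-- If `a_i + b_i + c_i`, `c_i a_{i+1}`, `z a_0` and `z c_{k-1}` all vanish, then
`z b_0 ⋯ b_{k-1} = ± z c_0 ⋯ c_{k-1} = 0`. -/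
lemma mul_prod_mem_of_chain {R : Type*} [CommRing R] {A : Ideal R} {a b c : ℕ → R} {z : R} {k : ℕ}
    (hk : 0 < k) (hsum : ∀ i < k, a i + b i + c i ∈ A) (ha : z * a 0 ∈ A)
    (hca : ∀ i, i + 1 < k → c i * a (i + 1) ∈ A) (hc : z * c (k - 1) ∈ A) :
    z * ∏ i ∈ Finset.range k, b i ∈ A := by
  have key : ∀ j ≤ k, z * ∏ i ∈ Finset.range j, b i -
      (-1) ^ j * (z * ∏ i ∈ Finset.range j, c i) ∈ A := by
    intro j
    induction j with
    | zero => simp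
    | succ j ih =>
      intro hj
      have haj : z * (∏ i ∈ Finset.range j, c i) * a j ∈ A := by
        cases j with
        | zero => simpa using ha
        | succ j =>
          rw [Finset.prod_range_succ, show z * ((∏ i ∈ Finset.range j, c i) * c j) * a (j + 1) =
            z * (∏ i ∈ Finset.range j, c i) * (c j * a (j + 1)) by ring]
          exact Ideal.mul_mem_left _ _ (hca j (by omega))
      rw [Finset.prod_range_succ, Finset.prod_range_succ,
        show z * ((∏ i ∈ Finset.range j, b i) * b j) -
            (-1) ^ (j + 1) * (z * ((∏ i ∈ Finset.range j, c i) * c j)) =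
          b j * (z * ∏ i ∈ Finset.range j, b i - (-1) ^ j * (z * ∏ i ∈ Finset.range j, c i)) +
            (-1) ^ j * (z * ∏ i ∈ Finset.range j, c i) * (a j + b j + c j) -
            (-1) ^ j * (z * (∏ i ∈ Finset.range j, c i) * a j) by ring]
      exact sub_mem (add_mem (Ideal.mul_mem_left _ _ (ih (by omega)))
        (Ideal.mul_mem_left _ _ (hsum j (by omega)))) (Ideal.mul_mem_left _ _ haj)
  obtain ⟨k, rfl⟩ : ∃ m, k = m + 1 := ⟨k - 1, by omega⟩
  have h := key (k + 1) le_rfl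
  refine (Submodule.sub_mem_iff_left _ ?_).mp h
  rw [Finset.prod_range_succ, show (-1) ^ (k + 1) * (z * ((∏ i ∈ Finset.range k, c i) * c k)) =
    (-1) ^ (k + 1) * (∏ i ∈ Finset.range k, c i) * (z * c k) by ring]
  exact Ideal.mul_mem_left _ _ hc

/-- For `n = 3k + 1` the vertex outside the blocks annihilates the product of the block centres too:
its two neighbours are the first and the last vertex of the chain of blocks. -/
lemma X_last_mul_blockProd_mem (hk : 0 < k) (hn : n = 3 * k + 1) {v : Fin n}
    (hv : v.val = 3 * k) (hL : blockCenters n k ⊆ L) :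
    X v * blockProd K n k ∈ cycleQuotIdeal K W L := by
  have hadj {u w : Fin n} (h : u.val + 1 = w.val ∨ (u.val + 1 = n ∧ w.val = 0) ∨
      w.val + 1 = u.val) : X u * X w ∈ cycleQuotIdeal K W L :=
    edgeIdeal_le_cycleQuotIdeal (X_mul_X_mem_edgeIdeal
      ((cycleGraph_adj_iff_val (by omega)).mpr (by omega)))
  refine mul_prod_mem_of_chain (a := fun i => X (Fin.ofNat n (3 * i)))
    (c := fun i => X (Fin.ofNat n (3 * i + 2))) hk (fun i hi => ?_) (hadj ?_)
    (fun i hi => hadj ?_) (hadj ?_)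
  · rw [← nbhdForm_blockCenter (by omega) (by omega)]
    exact nbhdForm_mem_cycleQuotIdeal (hL (mem_blockCenters hi))
  · rw [val_ofNat_of_lt (by omega)]; omega
  · rw [val_ofNat_of_lt (by omega), val_ofNat_of_lt (by omega)]; omega
  · rw [val_ofNat_of_lt (by omega)]; omega

lemma pairwise_blockCenters (hn : 3 ≤ n) (hk : 3 * k ≤ n) :
    (blockCenters n k).Pairwise fun b c => ∀ v ∈ W,
      v ∈ closedNbhd (SimpleGraph.cycleGraph n) b →
        v ∉ closedNbhd (SimpleGraph.cycleGraph n) c := by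
  refine List.pairwise_map.mpr ((List.pairwise_lt_range (n := k)).imp_of_mem ?_)
  intro i j hi hj hij v _ hv hv'
  rw [List.mem_range] at hi hj
  rw [mem_closedNbhd_cycleGraph hn, val_ofNat_of_lt (by omega)] at hv hv'
  omega

lemma length_blockCenters : (blockCenters n k).length = k := by
  simp [blockCenters]

/-- For `n = 3k` and `n = 3k + 1` the depth of `K[Δ_{C_n}]` is `k`. -/
theorem depth_cycleGraph_of_mod_ne_two (hk : 0 < k) (hn : n = 3 * k ∨ n = 3 * k + 1) :
    HasRegularSeq (irrelevantIdeal K (Fin n))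
        (MvPolynomial (Fin n) K ⧸ edgeIdeal K (SimpleGraph.cycleGraph n) Set.univ) k ∧
      ¬ HasRegularSeq (irrelevantIdeal K (Fin n))
        (MvPolynomial (Fin n) K ⧸ edgeIdeal K (SimpleGraph.cycleGraph n) Set.univ) (k + 1) := by
  have hd := pairwise_blockCenters (n := n) (k := k) (W := Set.univ) (by omega) (by omega)
  have h := hasRegularSeq_of_pairwise (K := K) (fun b _ => Set.mem_univ b) hd
  have h' := not_hasRegularSeq_of_pairwise (K := K) (fun b _ => Set.mem_univ b) hd
    (blockProd_notMem (by omega) (by omega) (fun v hv => absurd (Set.mem_univ v) hv)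
      fun b hb => Or.inl hb) fun v => ?_
  · rw [length_blockCenters] at h h'
    exact ⟨h, h'⟩
  · by_cases hv : v.val < 3 * k
    · exact X_mul_blockProd_mem_of_lt (by omega) (by omega) (List.Subset.refl _) hv
    · exact X_last_mul_blockProd_mem hk (by omega) (by omega) (List.Subset.refl _)

/-- For `n = 3k + 2` the depth of `K[Δ_{C_n}]` is `k + 1`. In the short exact sequence of the last
vertex, both the colon ideal, which belongs to a path together with an isolated vertex, and the edge
ideal of the path on the remaining vertices give depth at least `k + 1`; the former has depth
exactly `k + 1`. -/
theorem depth_cycleGraph_of_mod_eq_two (hk : 0 < k) (hn : n = 3 * k + 2) :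
    HasRegularSeq (irrelevantIdeal K (Fin n))
        (MvPolynomial (Fin n) K ⧸ edgeIdeal K (SimpleGraph.cycleGraph n) Set.univ) (k + 1) ∧
      ¬ HasRegularSeq (irrelevantIdeal K (Fin n))
        (MvPolynomial (Fin n) K ⧸ edgeIdeal K (SimpleGraph.cycleGraph n) Set.univ) (k + 2) := by
  obtain ⟨x, hx⟩ : ∃ x : Fin n, x.val = 3 * k + 1 := ⟨⟨3 * k + 1, by omega⟩, rfl⟩
  have hn3 : 3 ≤ n := by omega
  have hmem {v : Fin n} : v ∈ Set.univ \ (SimpleGraph.cycleGraph n).neighborSet x ↔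
      v.val ≠ 0 ∧ v.val ≠ 3 * k := by
    rw [Set.mem_sdiff, SimpleGraph.mem_neighborSet, cycleGraph_adj_iff_val hn3]
    have := v.isLt
    simp only [Set.mem_univ, true_and]
    omega
  -- The colon ideal: the blocks together with the isolated vertex `x`.
  have hL : ∀ b ∈ blockCenters n k ++ [x],
      b ∈ Set.univ \ (SimpleGraph.cycleGraph n).neighborSet x := by
    intro b hb
    rw [hmem]
    rcases List.mem_append.mp hb with hb | hb
    · obtain ⟨i, hi, hbi⟩ := exists_of_mem_blockCenters (by omega) hb
      omega
    · rw [List.mem_singleton.mp hb]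
      omega
  have hd : (blockCenters n k ++ [x]).Pairwise fun b c =>
      ∀ v ∈ Set.univ \ (SimpleGraph.cycleGraph n).neighborSet x,
        v ∈ closedNbhd (SimpleGraph.cycleGraph n) b →
          v ∉ closedNbhd (SimpleGraph.cycleGraph n) c := by
    refine List.pairwise_append.mpr ⟨pairwise_blockCenters hn3 (by omega),
      List.pairwise_singleton _ _, fun b hb c hc v hv hvb hvc => ?_⟩
    obtain ⟨i, hi, hbi⟩ := exists_of_mem_blockCenters (by omega) hb
    rw [List.mem_singleton.mp hc, mem_closedNbhd_cycleGraph hn3] at hvc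
    rw [mem_closedNbhd_cycleGraph hn3] at hvb
    rw [hmem] at hv
    omega
  have hcolon := hasRegularSeq_of_pairwise (K := K) hL hd
  have hcolon' := not_hasRegularSeq_of_pairwise (K := K) hL hd
    (blockProd_notMem (k := k) hn3 (by omega) (fun v hv => by rw [hmem] at hv; omega)
      fun b hb => (List.mem_append.mp hb).imp_right fun hb => ⟨hn, by
        rw [List.mem_singleton.mp hb]; omega⟩) fun v => by
    have hdead {v : Fin n} (hv : v.val = 0 ∨ v.val = 3 * k) : X v ∈ cycleQuotIdeal K
        (Set.univ \ (SimpleGraph.cycleGraph n).neighborSet x) (blockCenters n k ++ [x]) :=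
      edgeIdeal_le_cycleQuotIdeal (X_mem_edgeIdeal (by rw [hmem]; omega))
    by_cases hv : v.val < 3 * k
    · exact X_mul_blockProd_mem_of_lt hn3 (by omega) (List.subset_append_left _ _) hv
    · refine Ideal.mul_mem_right _ _ ?_
      by_cases hv' : v.val = 3 * k
      · exact hdead (Or.inr hv')
      · obtain rfl : v = x := Fin.ext (by omega)
        have h0 := val_ofNat_of_lt (show 0 < n by omega)
        have h3 := val_ofNat_of_lt (show 3 * k < n by omega)
        have h := nbhdForm_mem_cycleQuotIdeal (K := K)
          (W := Set.univ \ (SimpleGraph.cycleGraph n).neighborSet v)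
          (show v ∈ blockCenters n k ++ [v] by simp)
        rw [nbhdForm_cycleGraph hn3 (c := Fin.ofNat n (3 * k)) (d := Fin.ofNat n 0)
          (by omega) (by omega)] at h
        exact (add_mem_cancel_left (hdead (Or.inr h3))).mp
          ((add_mem_cancel_right (hdead (Or.inl h0))).mp h)
  rw [List.length_append, length_blockCenters, List.length_singleton] at hcolon hcolon'
  -- The path without `x`, covered by the closed neighbourhoods of `0, 3, …, 3k`.
  have hpath := hasRegularSeq_of_pairwise (K := K) (W := Set.univ \ {x})
    (L := (List.range (k + 1)).map fun i => Fin.ofNat n (3 * i)) (fun b hb => by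
      obtain ⟨i, hi, rfl⟩ := List.mem_map.mp hb
      rw [List.mem_range] at hi
      refine ⟨Set.mem_univ _, fun h => ?_⟩
      rw [Set.mem_singleton_iff, Fin.ext_iff, val_ofNat_of_lt (by omega)] at h
      omega) (by
      refine List.pairwise_map.mpr ((List.pairwise_lt_range (n := k + 1)).imp_of_mem ?_)
      intro i j hi hj hij v hv hvi hvj
      rw [List.mem_range] at hi hj
      have hv' : v.val ≠ x.val := fun h => hv.2 (Fin.ext h)
      rw [mem_closedNbhd_cycleGraph hn3, val_ofNat_of_lt (by omega)] at hvi hvj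
      omega)
  rw [List.length_map, List.length_range] at hpath
  obtain ⟨f, g, hf, hfg, hg⟩ := exists_shortExact_edgeIdeal (K := K)
    (G := SimpleGraph.cycleGraph n) (Set.mem_univ x)
  exact ⟨.middle hf hfg hg hcolon hpath, fun h => hcolon' (.left hf hfg hg h hpath)⟩

end Cycle

end InitialCM

theorem mainTheorem10 (K : Type*) [Field K] (n : ℕ) (hn : 3 ≤ n) :
    InitialCM.IsInitiallyCohenMacaulayGraph K (SimpleGraph.cycleGraph n) ↔
      ¬ n ≡ 1 [MOD 3] := by
  open InitialCM in
  have : NeZero n := ⟨by omega⟩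
  rw [IsInitiallyCohenMacaulayGraph, IsInitiallyCohenMacaulayComplex,
    stanleyReisnerIdeal_independenceComplex, IsInitiallyCohenMacaulay, Nat.ModEq]
  have hlower := le_indim_of_forall_maximal (K := K) (G := SimpleGraph.cycleGraph n)
    (d := (n + 2) / 3) fun F hF => by have := le_three_mul_card_of_maximal hn hF; omega
  have hupper (h : n % 3 ≠ 1) := (indim_le_of_maximal (K := K)
    (maximal_isIndepSet_mod_three hn h)).trans (Nat.cast_le.mpr card_mod_three_le)
  have hdepth : ∃ d : ℕ, HasRegularSeq (irrelevantIdeal K (Fin n))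
        (MvPolynomial (Fin n) K ⧸ edgeIdeal K (SimpleGraph.cycleGraph n) Set.univ) d ∧
      ¬ HasRegularSeq (irrelevantIdeal K (Fin n))
        (MvPolynomial (Fin n) K ⧸ edgeIdeal K (SimpleGraph.cycleGraph n) Set.univ) (d + 1) ∧
      d = (n + 1) / 3 := by
    by_cases h2 : n % 3 = 2
    · obtain ⟨h, h'⟩ := depth_cycleGraph_of_mod_eq_two (K := K) (n := n) (k := n / 3)
        (by omega) (by omega)
      exact ⟨_, h, h', by omega⟩
    · obtain ⟨h, h'⟩ := depth_cycleGraph_of_mod_ne_two (K := K) (n := n) (k := n / 3)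
        (by omega) (by omega)
      exact ⟨_, h, h', by omega⟩
  obtain ⟨d, hd, hd', rfl⟩ := hdepth
  rw [depth_eq_of_hasRegularSeq hd hd']
  constructor
  · rintro (h | h) hmod
    · exact hd' (.of_subsingleton _)
    · rw [← h] at hlower
      have : (n + 2) / 3 ≤ (n + 1) / 3 := by exact_mod_cast hlower
      omega
  · intro hmod
    have hdiv : (n + 1) / 3 = (n + 2) / 3 := by omega
    right
    rw [hdiv]
    exact le_antisymm hlower (hupper (by omega))

end
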